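/- For a real number $a$, the (homogeneous Diophantine approximation) type of $a$ is \[ L(a) := \inf\Bigl\{ c\in\mathbb{R} : \Bigl|a-\frac nm\Bigr| < \frac{c}{m^2} \text{ for some } m,n\in\mathbb{Z},\ m\neq 0\Bigr\}. \] An instance of the Continuous Skolem Problem consists of a differential equation $f^{(n)}+a_{n-1}f^{(n-1)}+\dots+a_0f=0$ with real algebraic coefficients, real algebraic initial values $f(0),\dots,f^{(n-1)}(0)$, and a bounded or unbounded interval $I\subseteq\mathbb{R}_{\ge 0}$ with rational endpoints (only a rational left endpoint if $I$ is unbounded); the question is whether the unique solution $f$ has a zero in $I$. Real algebraic numbers are given to an algorithm by a nonzero rational polynomial having the number as a root, together with a rational approximation and accuracy that separate the number from all other complex roots of the polynomial. The frequencies of an instance are the imaginary parts of the complex roots of its characteristic polynomial $x^n+a_{n-1}x^{n-1}+\dots+a_0$. \textbf{Theorem.} Let $a$ be a positive real algebraic number. If the Continuous Skolem Problem is decidable, then $L(a)$ is computable to arbitrary precision, that is, there is an algorithm which, given any rational $\varepsilon>0$, returns a rational $q$ with $|q-L(a)|<\varepsilon$. The same conclusion holds if one only assumes that the Continuous Skolem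 Problem is decidable when restricted to instances whose frequencies span a $\mathbb{Q}$-vector space of dimension two. -/

import Mathlib

open Polynomial

/-! ### Diophantine approximation type and computable reals -/

/-- The (homogeneous Diophantine approximation) type of a real number `a`: the infimum of all `c`
such that `|a - n / m| < c / m ^ 2` for some integers `m ≠ 0` and `n`. -/
noncomputable def diophantineType (a : ℝ) : ℝ :=
  sInf {c : ℝ | ∃ m n : ℤ, m ≠ 0 ∧ |a - (n : ℝ) / (m : ℝ)| < c / (m : ℝ) ^ 2}

/-- Codes of rational numbers: `(p, q, r)` stands for `(p - q) / (r + 1)`. -/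
abbrev RatCode : Type := ℕ × ℕ × ℕ

/-- The rational number with a given code; every rational number has a code. -/
def ratVal (c : RatCode) : ℚ := ((c.1 : ℚ) - (c.2.1 : ℚ)) / ((c.2.2 : ℚ) + 1)

/-- `x` can be computed to within arbitrary precision: some algorithm maps every rational `ε > 0`
to a rational `q` with `|q - x| < ε`. -/
def IsComputableReal (x : ℝ) : Prop :=
  ∃ g : RatCode → RatCode, Computable g ∧
    ∀ e : RatCode, 0 < ratVal e → |(ratVal (g e) : ℝ) - x| < (ratVal e : ℝ)

/-! ### Representation of real algebraic numbers -/

/-- Codes of real algebraic numbers: the list of coefficients of a rational polynomial (constant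
coefficient first), a rational approximation and a rational accuracy. -/
abbrev AlgCode : Type := List RatCode × RatCode × RatCode

/-- The polynomial with a given list of coefficients, constant coefficient first. -/
noncomputable def polyVal (l : List RatCode) : ℚ[X] :=
  l.foldr (fun c P => C (ratVal c) + X * P) 0

/-- The code `(P, p, r)` denotes the real number `α` if `α` is a root of the nonzero polynomial `P`
that lies within distance `r` of `p`, and no other complex root of `P` does. -/
def AlgCode.Denotes (c : AlgCode) (α : ℝ) : Prop :=
  polyVal c.1 ≠ 0 ∧ aeval α (polyVal c.1) = 0 ∧ |α - (ratVal c.2.1 : ℝ)| < (ratVal c.2.2 : ℝ) ∧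
    ∀ z : ℂ, aeval z (polyVal c.1) = 0 → ‖z - (ratVal c.2.1 : ℂ)‖ < (ratVal c.2.2 : ℝ) →
      z = (α : ℂ)

/-! ### The Continuous Skolem Problem -/

/-- The data of an instance: the differential equation
`f⁽ⁿ⁾ + aₙ₋₁ f⁽ⁿ⁻¹⁾ + … + a₀ f = 0` with `aⱼ = coeff j`, the initial conditions
`f⁽ʲ⁾(0) = init j`, and the interval in which a zero is sought. -/
structure SkolemInstance where
  order : ℕ
  coeff : Fin order → ℝ
  init : Fin order → ℝ
  interval : Set ℝ

namespace SkolemInstance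

/-- `f` solves the differential equation with the given initial conditions. (The solution exists,
is unique, and its restriction to the nonnegative reals is the solution there.) -/
def IsSolution (S : SkolemInstance) (f : ℝ → ℝ) : Prop :=
  ContDiff ℝ S.order f ∧
    (∀ t : ℝ, iteratedDeriv S.order f t + ∑ j : Fin S.order, S.coeff j * iteratedDeriv j f t = 0) ∧
    ∀ j : Fin S.order, iteratedDeriv j f 0 = S.init j

/-- The question asked: does the solution have a zero in the interval? -/
def HasZero (S : SkolemInstance) : Prop :=
  ∃ f : ℝ → ℝ, S.IsSolution f ∧ ∃ t ∈ S.interval, f t = 0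

/-- The characteristic polynomial, over the complex numbers. -/
noncomputable def charPoly (S : SkolemInstance) : ℂ[X] :=
  X ^ S.order + ∑ j : Fin S.order, C (S.coeff j : ℂ) * X ^ (j : ℕ)

/-- The frequencies: the imaginary parts of the characteristic roots. -/
def frequencies (S : SkolemInstance) : Set ℝ :=
  {ω : ℝ | ∃ z : ℂ, S.charPoly.IsRoot z ∧ z.im = ω}

/-- There are exactly two rationally linearly independent frequencies: the frequencies span a
rational vector space of dimension two. -/
def HasTwoFrequencies (S : SkolemInstance) : Prop :=
  Module.finrank ℚ (Submodule.span ℚ S.frequencies) = 2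

end SkolemInstance

/-- Codes of intervals with rational endpoints: the lower endpoint and, unless the interval is
unbounded above, the upper endpoint, each with a flag telling whether it belongs to the interval. -/
abbrev IntervalCode : Type := (RatCode × Bool) × Option (RatCode × Bool)

/-- The interval with a given code. -/
def intervalVal : IntervalCode → Set ℝ
  | ((l, true), none) => Set.Ici (ratVal l : ℝ)
  | ((l, false), none) => Set.Ioi (ratVal l : ℝ)
  | ((l, true), some (u, true)) => Set.Icc (ratVal l : ℝ) (ratVal u : ℝ)
  | ((l, true), some (u, false)) => Set.Ico (ratVal l : ℝ) (ratVal u : ℝ)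
  | ((l, false), some (u, true)) => Set.Ioc (ratVal l : ℝ) (ratVal u : ℝ)
  | ((l, false), some (u, false)) => Set.Ioo (ratVal l : ℝ) (ratVal u : ℝ)

/-- Codes of instances of the Continuous Skolem Problem: the list of pairs of codes of `aⱼ` and
`f⁽ʲ⁾(0)` for `j = 0, …, n - 1`, and the code of the interval. -/
abbrev SkolemCode : Type := List (AlgCode × AlgCode) × IntervalCode

/-- The code `c` represents the instance `S`. In particular all coefficients and initial values
are real algebraic, and the interval is a subset of the nonnegative reals with rational
endpoints. -/
def SkolemCode.Represents (c : SkolemCode) (S : SkolemInstance) : Prop :=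
  (∃ h : c.1.length = S.order, ∀ j : Fin c.1.length,
    AlgCode.Denotes (c.1.get j).1 (S.coeff (j.cast h)) ∧
      AlgCode.Denotes (c.1.get j).2 (S.init (j.cast h))) ∧
  S.interval = intervalVal c.2 ∧ S.interval ⊆ Set.Ici 0

/-- The Continuous Skolem Problem is decidable for the instances with property `Q`: some algorithm,
started on any code of any such instance, halts and answers correctly. Nothing is asked of its
behaviour on other inputs. -/
def SkolemDecidableOn (Q : SkolemInstance → Prop) : Prop :=
  ∃ D : SkolemCode →. Bool, Partrec D ∧
    ∀ (c : SkolemCode) (S : SkolemInstance), c.Represents S → Q S →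
      ∃ b ∈ D c, (b = true ↔ S.HasZero)

/-- The Continuous Skolem Problem is decidable. -/
def SkolemDecidable : Prop := SkolemDecidableOn fun _ => True

/-! Write L for the type of `a`. The oracle is used to compare 8π⁴L² with rational numbers, through
the function f(t) = e^t (1 - cos t) + (t² + 3t)(1 - cos at) (`approxFunction`). Both summands are
nonnegative for t ≥ 0, so a bounded value at a large t forces t to be exponentially close to some
2πm and at to be within O(1/t) of some 2πn; the value is then close to 8π⁴(m|ma - n|)². Hence f ≥
8π⁴L² from some T on (`exists_approxFunction_ge`). If the infimum L is not attained, it is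
approached along unbounded denominators, and the intermediate value theorem produces every c > 8π⁴L²
as a value on [T, ∞) (`exists_approxFunction_eq`). So whether f - c has a zero there decides how c
compares with 8π⁴L², except when the two are equal, which an approximate comparison tolerates
(`isComputableReal_of_approx_decider`).

If L is attained, L = m|ma - n| is algebraic, and for L > 0 the oracle locates it as a zero of t² -
Lt. The cases L = 0 and `a` rational are immediate. Neither the case distinction nor T is computed:
only the existence of an algorithm is claimed.

All queries share the characteristic polynomial `twoFrequencyPoly a`, whose frequencies 0, ±1, ±a
span dimension two for irrational `a`. Within each family of queries only the interval and the
rational value f(0) vary, so the remaining algebraic data are finitely many fixed codes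
(`exists_zero_decider`). -/

/-! ### Codes of rational and real algebraic numbers -/

theorem ratVal_surjective : Function.Surjective ratVal := by
  intro q
  refine ⟨(q.num.toNat, (-q.num).toNat, q.den - 1), ?_⟩
  have h1 : ((q.num.toNat : ℚ) - ((-q.num).toNat : ℚ)) = q.num := by
    have : (q.num.toNat : ℤ) - ((-q.num).toNat : ℤ) = q.num := by omega
    exact_mod_cast this
  have h2 : ((q.den - 1 : ℕ) : ℚ) + 1 = q.den := by
    have := q.den_pos
    have : q.den - 1 + 1 = q.den := by omega
    exact_mod_cast this
  simp only [ratVal, h1, h2, Rat.num_div_den]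

theorem polyVal_cons (c : RatCode) (l : List RatCode) :
    polyVal (c :: l) = C (ratVal c) + X * polyVal l := rfl

theorem polyVal_nil : polyVal [] = 0 := rfl

theorem polyVal_surjective : Function.Surjective polyVal := by
  suffices h : ∀ (n : ℕ) (P : ℚ[X]), P.natDegree ≤ n → ∃ l, polyVal l = P from
    fun P => h _ P le_rfl
  intro n
  induction n with
  | zero =>
    intro P hP
    obtain ⟨c, hc⟩ := ratVal_surjective (P.coeff 0)
    refine ⟨[c], ?_⟩
    rw [polyVal_cons, polyVal_nil, hc, mul_zero, add_zero]
    exact (eq_C_of_natDegree_le_zero hP).symm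
  | succ n ih =>
    intro P hP
    obtain ⟨c, hc⟩ := ratVal_surjective (P.coeff 0)
    obtain ⟨l, hl⟩ := ih P.divX (by rw [natDegree_divX_eq_natDegree_tsub_one]; omega)
    refine ⟨c :: l, ?_⟩
    rw [polyVal_cons, hl, hc, add_comm]
    exact X_mul_divX_add P

/-- Every real algebraic number has a code. -/
theorem exists_algCode {α : ℝ} (h : IsAlgebraic ℚ α) : ∃ c : AlgCode, c.Denotes α := by
  obtain ⟨P, hP0, hP⟩ := h
  obtain ⟨l, rfl⟩ := polyVal_surjective P
  have hfin : {z : ℂ | aeval z (polyVal l) = 0 ∧ z ≠ α}.Finite := by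
    refine ((polyVal l).rootSet_finite ℂ).subset fun z hz => ?_
    rw [mem_rootSet]
    exact ⟨hP0, hz.1⟩
  obtain ⟨δ, hδ, hball⟩ := Metric.isOpen_iff.1 hfin.isClosed.isOpen_compl (α : ℂ) (by simp)
  -- Half of δ, because the isolating disc is centred at p rather than at α, so the triangle
  -- inequality spends r twice.
  obtain ⟨r, hr0, hr⟩ := exists_rat_btwn (half_pos hδ)
  obtain ⟨p, hp1, hp2⟩ := exists_rat_btwn (show α < α + (r : ℝ) by linarith)
  obtain ⟨cr, rfl⟩ := ratVal_surjective r
  obtain ⟨cp, rfl⟩ := ratVal_surjective p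
  have hd : |α - (ratVal cp : ℝ)| < (ratVal cr : ℝ) := by
    rw [abs_lt]; constructor <;> linarith
  refine ⟨(l, cp, cr), hP0, hP, hd, fun z hz hzr => ?_⟩
  by_contra hne
  refine hball (?_ : z ∈ Metric.ball (α : ℂ) δ) ⟨hz, hne⟩
  rw [Metric.mem_ball, dist_eq_norm]
  have h1 : ‖(ratVal cp : ℂ) - (α : ℂ)‖ < (ratVal cr : ℝ) := by
    have : (ratVal cp : ℂ) - (α : ℂ) = (((ratVal cp : ℝ) - α : ℝ) : ℂ) := by push_cast; rfl
    rw [this, Complex.norm_real, Real.norm_eq_abs, abs_sub_comm]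
    exact hd
  calc ‖z - α‖ = ‖(z - (ratVal cp : ℂ)) + ((ratVal cp : ℂ) - α)‖ := by ring_nf
    _ ≤ _ := norm_add_le _ _
    _ < δ := by dsimp only at hzr; linarith

/-- A code of the rational number with code `s`, viewed as a real algebraic number. -/
def ratAlgCode (s : RatCode) : AlgCode := ([(s.2.1, s.1, s.2.2), (1, 0, 0)], s, (1, 0, 0))

theorem ratAlgCode_denotes (s : RatCode) : (ratAlgCode s).Denotes (ratVal s : ℝ) := by
  have h1 : polyVal (ratAlgCode s).1 = X - C (ratVal s) := by
    have e1 : ratVal (s.2.1, s.1, s.2.2) = - ratVal s := by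
      simp only [ratVal]; ring
    have e2 : ratVal (1, 0, 0) = 1 := by simp [ratVal]
    simp only [ratAlgCode, polyVal_cons, polyVal_nil, e1, e2]
    simp only [map_neg, map_one]
    ring
  refine ⟨?_, ?_, ?_, ?_⟩
  · rw [h1]; exact X_sub_C_ne_zero _
  · rw [h1]; simp
  · simp [ratAlgCode, ratVal]
  · intro z hz _
    rw [h1] at hz
    simp only [map_sub, aeval_X, aeval_C, eq_ratCast] at hz
    rw [sub_eq_zero.1 hz]
    push_cast
    rfl

theorem primrec_ratAlgCode : Primrec ratAlgCode := by
  unfold ratAlgCode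
  refine Primrec.pair (Primrec.list_cons.comp ?_ (Primrec.const _))
    (Primrec.pair Primrec.id (Primrec.const _))
  exact Primrec.pair (Primrec.fst.comp Primrec.snd)
    (Primrec.pair Primrec.fst (Primrec.snd.comp Primrec.snd))

/-! ### Constant-coefficient differential operators on smooth functions -/

/-- The algebra of smooth real functions. -/
def smoothFunctions : Subalgebra ℝ (ℝ → ℝ) where
  carrier := {f | ContDiff ℝ (⊤ : ℕ∞) f}
  mul_mem' {f g} (hf : ContDiff ℝ _ f) (hg : ContDiff ℝ _ g) :=
    show ContDiff ℝ (⊤ : ℕ∞) fun x => f x * g x from hf.mul hg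
  add_mem' {f g} (hf : ContDiff ℝ _ f) (hg : ContDiff ℝ _ g) :=
    show ContDiff ℝ (⊤ : ℕ∞) fun x => f x + g x from hf.add hg
  algebraMap_mem' c := show ContDiff ℝ (⊤ : ℕ∞) fun _ : ℝ => c from contDiff_const

namespace smoothFunctions

theorem mem_iff {f : ℝ → ℝ} : f ∈ smoothFunctions ↔ ContDiff ℝ (⊤ : ℕ∞) f := Iff.rfl

theorem differentiable (f : smoothFunctions) : Differentiable ℝ f.1 :=
  (mem_iff.1 f.2).differentiable (by simp)

theorem contDiff_deriv (f : smoothFunctions) : ContDiff ℝ (⊤ : ℕ∞) (deriv f.1) :=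
  (contDiff_infty_iff_deriv.1 (mem_iff.1 f.2)).2

/-- Differentiation of smooth functions. -/
noncomputable def D : Derivation ℝ smoothFunctions smoothFunctions :=
  Derivation.mk'
    { toFun := fun f => ⟨deriv f.1, contDiff_deriv f⟩
      map_add' := fun f g => Subtype.ext <| funext fun t =>
        deriv_add (differentiable f t) (differentiable g t)
      map_smul' := fun c f => Subtype.ext <| funext fun t =>
        deriv_const_mul c (differentiable f t) }
    (fun f g => Subtype.ext <| funext fun t => by
      have := deriv_mul (differentiable f t) (differentiable g t)
      change deriv (f.1 * g.1) t = f.1 t * deriv g.1 t + g.1 t * deriv f.1 t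
      rw [this]; ring)

theorem coe_D (f : smoothFunctions) : (D f).1 = deriv f.1 := rfl

theorem coe_D_pow (j : ℕ) (f : smoothFunctions) :
    (((D : smoothFunctions →ₗ[ℝ] smoothFunctions) ^ j) f).1 = iteratedDeriv j f.1 := by
  induction j with
  | zero => simp
  | succ j ih =>
    rw [pow_succ', Module.End.mul_apply, iteratedDeriv_succ, ← ih]
    rfl

/-- The constant-coefficient differential operator with symbol `p`. -/
noncomputable def op (p : ℝ[X]) : Module.End ℝ smoothFunctions :=
  aeval (D : smoothFunctions →ₗ[ℝ] smoothFunctions) p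

theorem op_apply (p : ℝ[X]) (f : smoothFunctions) (t : ℝ) :
    (op p f).1 t = ∑ j ∈ Finset.range (p.natDegree + 1), p.coeff j * iteratedDeriv j f.1 t := by
  rw [op, aeval_eq_sum_range, LinearMap.sum_apply]
  have (s : Finset ℕ) (g : ℕ → smoothFunctions) : (∑ j ∈ s, g j).1 t = ∑ j ∈ s, (g j).1 t := by
    simp
  rw [this]
  refine Finset.sum_congr rfl fun j _ => ?_
  rw [← coe_D_pow]
  rfl

theorem op_mul (p q : ℝ[X]) (f : smoothFunctions) : op (p * q) f = op p (op q f) := by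
  simp [op]

theorem op_X (f : smoothFunctions) : op X f = D f := by simp [op]

theorem op_C (c : ℝ) (f : smoothFunctions) : op (C c) f = c • f := by
  simp [op]

theorem op_add (p q : ℝ[X]) (f : smoothFunctions) : op (p + q) f = op p f + op q f := by
  simp [op]

theorem op_sub (p q : ℝ[X]) (f : smoothFunctions) : op (p - q) f = op p f - op q f := by
  simp [op]

theorem op_eq_zero_of_dvd {p q : ℝ[X]} (h : p ∣ q) {f : smoothFunctions} (hf : op p f = 0) :
    op q f = 0 := by
  obtain ⟨r, rfl⟩ := h
  rw [mul_comm, op_mul, hf, map_zero]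

/-- The identity function. -/
def t : smoothFunctions := ⟨fun s => s, mem_iff.2 contDiff_id⟩

/-- The exponential function. -/
noncomputable def exp : smoothFunctions := ⟨Real.exp, mem_iff.2 Real.contDiff_exp⟩

/-- The function `s ↦ cos (b * s)`. -/
noncomputable def cos (b : ℝ) : smoothFunctions :=
  ⟨fun s => Real.cos (b * s), mem_iff.2 (Real.contDiff_cos.comp (contDiff_const.mul contDiff_id))⟩

/-- The function `s ↦ sin (b * s)`. -/
noncomputable def sin (b : ℝ) : smoothFunctions :=
  ⟨fun s => Real.sin (b * s), mem_iff.2 (Real.contDiff_sin.comp (contDiff_const.mul contDiff_id))⟩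

theorem D_t : D t = 1 := Subtype.ext <| funext fun s => by
  rw [coe_D]; exact deriv_id s

theorem D_exp : D exp = exp := Subtype.ext <| by
  rw [coe_D]; exact Real.deriv_exp

theorem D_cos (b : ℝ) : D (cos b) = (-b) • sin b := Subtype.ext <| funext fun s => by
  rw [coe_D]
  have h : HasDerivAt (fun s => Real.cos (b * s)) (-Real.sin (b * s) * (b * 1)) s :=
    (((hasDerivAt_id s).const_mul b).cos)
  change deriv (fun s => Real.cos (b * s)) s = (-b) * Real.sin (b * s)
  rw [h.deriv]; ring

theorem D_sin (b : ℝ) : D (sin b) = b • cos b := Subtype.ext <| funext fun s => by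
  rw [coe_D]
  have h : HasDerivAt (fun s => Real.sin (b * s)) (Real.cos (b * s) * (b * 1)) s :=
    (((hasDerivAt_id s).const_mul b).sin)
  change deriv (fun s => Real.sin (b * s)) s = b * Real.cos (b * s)
  rw [h.deriv]; ring

/-- The commutator of a differential operator with multiplication by the variable. -/
theorem op_t_mul (p : ℝ[X]) (f : smoothFunctions) :
    op p (t * f) = t * op p f + op (derivative p) f := by
  induction p using Polynomial.induction_on' generalizing f with
  | add p q hp hq => rw [op_add, op_add, hp, hq, derivative_add, op_add]; ring
  | monomial n c =>
    induction n generalizing f with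
    | zero => simp [op]
    | succ n ih =>
      have e : (monomial (n + 1) c : ℝ[X]) = monomial n c * X := by
        rw [monomial_mul_X]
      rw [e, op_mul, op_X, Derivation.leibniz, D_t, map_add, smul_eq_mul, smul_eq_mul, mul_one, ih,
        derivative_mul, derivative_X, mul_one, op_add, op_mul, op_mul, op_X]
      ring

/-- The commutator with t contributes the derivative of p ^ (k + 1), which is still divisible by p ^
k. This yields the polynomial factors t and t² in solutions. -/
theorem op_pow_t_mul {p : ℝ[X]} {k : ℕ} {f : smoothFunctions} (h : op (p ^ k) f = 0) :
    op (p ^ (k + 1)) (t * f) = 0 := by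
  rw [op_t_mul, op_eq_zero_of_dvd (pow_dvd_pow p k.le_succ) h, mul_zero, zero_add]
  refine op_eq_zero_of_dvd ?_ h
  rw [derivative_pow_succ]
  exact Dvd.intro_left (C (k + 1 : ℝ)) rfl |>.mul_right _

theorem op_one : op X (1 : smoothFunctions) = 0 := by simp [op_X]

theorem op_cos (b : ℝ) : op (X ^ 2 + C (b ^ 2)) (cos b) = 0 := by
  rw [op_add, pow_two, op_mul, op_X, op_X, op_C, D_cos, Derivation.map_smul, D_sin, smul_smul, ← add_smul]
  simp [pow_two]

theorem op_exp : op (X - C 1) exp = 0 := by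
  rw [op_sub, op_X, op_C, D_exp]; simp

theorem op_exp_mul_cos_one : op (X ^ 2 - C 2 * X + C 2) (exp * cos 1) = 0 := by
  rw [op_add, op_sub, op_mul, op_C, op_C, pow_two, op_mul, op_X, op_X]
  simp only [Derivation.leibniz, map_add, D_exp, D_cos, D_sin, smul_eq_mul, one_smul, neg_smul,
    map_neg, two_smul]
  ring

theorem op_exp_mul_sin_one : op (X ^ 2 - C 2 * X + C 2) (exp * sin 1) = 0 := by
  rw [op_add, op_sub, op_mul, op_C, op_C, pow_two, op_mul, op_X, op_X]
  simp only [Derivation.leibniz, map_add, D_exp, D_cos, D_sin, smul_eq_mul, one_smul, neg_smul,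
    two_smul]
  ring

/-- The smooth functions all of whose derivatives at the origin are algebraic. -/
noncomputable def algebraicJets : Subring smoothFunctions where
  carrier := {f | ∀ j, IsAlgebraic ℚ
    ((((D : smoothFunctions →ₗ[ℝ] smoothFunctions) ^ j) f).1 0)}
  mul_mem' := by
    intro f g hf hg j
    induction j generalizing f g with
    | zero => exact (hf 0).mul (hg 0)
    | succ j ih =>
      have hf' : ∀ i, IsAlgebraic ℚ ((((D : smoothFunctions →ₗ[ℝ] smoothFunctions) ^ i) (D f)).1 0)
        := fun i => by
          have := hf (i + 1)
          rwa [pow_succ, Module.End.mul_apply] at this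
      have hg' : ∀ i, IsAlgebraic ℚ ((((D : smoothFunctions →ₗ[ℝ] smoothFunctions) ^ i) (D g)).1 0)
        := fun i => by
          have := hg (i + 1)
          rwa [pow_succ, Module.End.mul_apply] at this
      rw [pow_succ, Module.End.mul_apply]
      change IsAlgebraic ℚ ((((D : smoothFunctions →ₗ[ℝ] smoothFunctions) ^ j) (D (f * g))).1 0)
      rw [Derivation.leibniz, map_add, smul_eq_mul, smul_eq_mul]
      exact (ih hf hg').add (ih hg hf')
  one_mem' := by
    intro j
    cases j with
    | zero => exact isAlgebraic_one
    | succ j =>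
      rw [pow_succ, Module.End.mul_apply]
      change IsAlgebraic ℚ ((((D : smoothFunctions →ₗ[ℝ] smoothFunctions) ^ j) (D 1)).1 0)
      rw [D.map_one_eq_zero, map_zero]
      exact isAlgebraic_zero
  add_mem' := by
    intro f g hf hg j
    rw [map_add]
    exact (hf j).add (hg j)
  zero_mem' := by
    intro j
    rw [map_zero]
    exact isAlgebraic_zero
  neg_mem' := by
    intro f hf j
    rw [map_neg]
    exact (hf j).neg

theorem mem_algebraicJets_of_D {f : smoothFunctions} (h0 : IsAlgebraic ℚ (f.1 0))
    (h : D f ∈ algebraicJets) : f ∈ algebraicJets := by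
  intro j
  cases j with
  | zero => exact h0
  | succ j =>
    rw [pow_succ, Module.End.mul_apply]
    exact h j

theorem smul_mem_algebraicJets {c : ℝ} (hc : IsAlgebraic ℚ c) {f : smoothFunctions}
    (hf : f ∈ algebraicJets) : c • f ∈ algebraicJets := by
  intro j
  rw [map_smul]
  exact hc.mul (hf j)

theorem t_mem_algebraicJets : t ∈ algebraicJets :=
  mem_algebraicJets_of_D isAlgebraic_zero (by rw [D_t]; exact one_mem _)

theorem exp_mem_algebraicJets : exp ∈ algebraicJets := by
  intro j
  have : ((D : smoothFunctions →ₗ[ℝ] smoothFunctions) ^ j) exp = exp := by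
    induction j with
    | zero => rfl
    | succ j ih =>
      rw [pow_succ, Module.End.mul_apply]
      change ((D : smoothFunctions →ₗ[ℝ] smoothFunctions) ^ j) (D exp) = exp
      rw [D_exp, ih]
  rw [this]
  change IsAlgebraic ℚ (Real.exp 0)
  rw [Real.exp_zero]
  exact isAlgebraic_one

theorem cos_sin_mem_algebraicJets {b : ℝ} (hb : IsAlgebraic ℚ b) :
    cos b ∈ algebraicJets ∧ sin b ∈ algebraicJets := by
  suffices h : ∀ j,
      IsAlgebraic ℚ ((((D : smoothFunctions →ₗ[ℝ] smoothFunctions) ^ j) (cos b)).1 0) ∧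
      IsAlgebraic ℚ ((((D : smoothFunctions →ₗ[ℝ] smoothFunctions) ^ j) (sin b)).1 0) from
    ⟨fun j => (h j).1, fun j => (h j).2⟩
  intro j
  induction j with
  | zero =>
    constructor
    · change IsAlgebraic ℚ (Real.cos (b * 0))
      rw [mul_zero, Real.cos_zero]; exact isAlgebraic_one
    · change IsAlgebraic ℚ (Real.sin (b * 0))
      rw [mul_zero, Real.sin_zero]; exact isAlgebraic_zero
  | succ j ih =>
    rw [pow_succ, Module.End.mul_apply, Module.End.mul_apply]
    change IsAlgebraic ℚ ((((D : smoothFunctions →ₗ[ℝ] smoothFunctions) ^ j) (D (cos b))).1 0) ∧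
      IsAlgebraic ℚ ((((D : smoothFunctions →ₗ[ℝ] smoothFunctions) ^ j) (D (sin b))).1 0)
    rw [D_cos, D_sin, map_smul, map_smul]
    exact ⟨hb.neg.mul ih.2, hb.mul ih.1⟩

end smoothFunctions

/-! ### Uniqueness of solutions and instances with a prescribed solution -/

/-- A solution of a linear differential equation is determined by its initial values. -/
theorem SkolemInstance.IsSolution.unique {S : SkolemInstance} {f g : ℝ → ℝ} (hf : S.IsSolution f)
    (hg : S.IsSolution g) : f = g := by
  obtain ⟨n, a, c, I⟩ := S
  -- The companion first-order system satisfied by the vector of derivatives of orders below n.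
  have key (h : ℝ → ℝ) (hh : (SkolemInstance.mk n a c I).IsSolution h) (t : ℝ) :
      HasDerivAt (fun s (j : Fin n) => iteratedDeriv j h s)
        ((fun (y : Fin n → ℝ) (j : Fin n) =>
          if hj : (j : ℕ) + 1 < n then y ⟨j + 1, hj⟩ else - ∑ i, a i * y i)
          (fun j : Fin n => iteratedDeriv j h t)) t := by
    rw [hasDerivAt_pi]
    intro j
    obtain ⟨h1, h2, -⟩ := hh
    dsimp only at h1 h2
    have hd : HasDerivAt (iteratedDeriv j h) (iteratedDeriv (j + 1) h t) t := by
      rw [iteratedDeriv_succ]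
      refine DifferentiableAt.hasDerivAt ?_
      exact (h1.differentiable_iteratedDeriv j (by exact_mod_cast j.2)) t
    beta_reduce
    split_ifs with hj
    · exact hd
    · have : (j : ℕ) + 1 = n := by omega
      rw [this] at hd
      rw [eq_neg_of_add_eq_zero_left (h2 t)] at hd
      exact hd
  let A : (Fin n → ℝ) →ₗ[ℝ] (Fin n → ℝ) :=
    { toFun := fun y j => if hj : (j : ℕ) + 1 < n then y ⟨j + 1, hj⟩ else - ∑ i, a i * y i
      map_add' := fun y z => by
        ext j; by_cases hj : (j : ℕ) + 1 < n
        · simp [hj]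
        · simp [hj, mul_add, Finset.sum_add_distrib]; ring
      map_smul' := fun r y => by
        ext j; by_cases hj : (j : ℕ) + 1 < n
        · simp [hj]
        · simp [hj, Finset.mul_sum, mul_left_comm] }
  have hlip := (LinearMap.toContinuousLinearMap A).lipschitz
  have hEq : (fun s (j : Fin n) => iteratedDeriv j f s) =
      fun s (j : Fin n) => iteratedDeriv j g s := by
    refine ODE_solution_unique_univ (v := fun _ => A) (s := fun _ => Set.univ) (t₀ := 0)
      (fun _ => hlip.lipschitzOnWith) (fun t => ⟨key f hf t, trivial⟩)
      (fun t => ⟨key g hg t, trivial⟩) ?_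
    funext j
    exact (hf.2.2 j).trans (hg.2.2 j).symm
  funext t
  -- In order zero the state vector is empty, but the equation itself says that the function
  -- vanishes.
  rcases Nat.eq_zero_or_pos n with rfl | hn
  · have h1 := hf.2.1 t
    have h2 := hg.2.1 t
    simp at h1 h2
    rw [h1, h2]
  · simpa using congrFun (congrFun hEq t) ⟨0, hn⟩

/-- The instance of the Continuous Skolem Problem with characteristic polynomial `χ` solved by the
function `f`. -/
noncomputable def skolemInstanceOf (χ : ℝ[X]) (f : smoothFunctions) (I : Set ℝ) :
    SkolemInstance where
  order := χ.natDegree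
  coeff j := χ.coeff j
  init j := iteratedDeriv j f.1 0
  interval := I

section skolemInstanceOf

variable {χ : ℝ[X]} {f : smoothFunctions} {I : Set ℝ}

theorem skolemInstanceOf_isSolution (hχ : χ.Monic) (hf : smoothFunctions.op χ f = 0) :
    (skolemInstanceOf χ f I).IsSolution f.1 := by
  refine ⟨(smoothFunctions.mem_iff.1 f.2).of_le (by exact_mod_cast le_top), fun t => ?_,
    fun j => rfl⟩
  have h := smoothFunctions.op_apply χ f t
  rw [hf, Finset.sum_range_succ, hχ.coeff_natDegree, one_mul, Finset.sum_range] at h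
  rw [add_comm]
  exact h.symm

/-- By uniqueness, the solution quantified over in `HasZero` must be f itself. -/
theorem skolemInstanceOf_hasZero_iff (hχ : χ.Monic) (hf : smoothFunctions.op χ f = 0) :
    (skolemInstanceOf χ f I).HasZero ↔ ∃ t ∈ I, f.1 t = 0 := by
  constructor
  · rintro ⟨g, hg, t, ht, h0⟩
    exact ⟨t, ht, by rwa [(skolemInstanceOf_isSolution hχ hf).unique hg]⟩
  · rintro ⟨t, ht, h0⟩
    exact ⟨f.1, skolemInstanceOf_isSolution hχ hf, t, ht, h0⟩

theorem skolemInstanceOf_charPoly (hχ : χ.Monic) :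
    (skolemInstanceOf χ f I).charPoly = χ.map (algebraMap ℝ ℂ) := by
  conv_rhs => rw [hχ.as_sum]
  simp only [SkolemInstance.charPoly, skolemInstanceOf, Polynomial.map_add, Polynomial.map_pow,
    map_X, Polynomial.map_sum, Polynomial.map_mul, map_C, Complex.coe_algebraMap]
  rw [Finset.sum_range]
  rfl

end skolemInstanceOf

/-! ### The common characteristic polynomial -/

/-- A characteristic polynomial with frequencies `0`, `±1` and `±a`. -/
noncomputable def twoFrequencyPoly (a : ℝ) : ℝ[X] :=
  -- The factors annihilate, in this order: 1, t, t²; e^t; e^t cos t and e^t sin t; and t^j cos at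
  -- for j ≤ 2.
  X ^ 3 * ((X - C 1) * ((X ^ 2 - C 2 * X + C 2) * (X ^ 2 + C (a ^ 2)) ^ 3))

theorem twoFrequencyPoly_factor_monic :
    (X ^ 2 - C 2 * X + C 2 : ℝ[X]).Monic ∧ (X ^ 2 - C 2 * X + C 2 : ℝ[X]).natDegree = 2 := by
  constructor
  · monicity!
  · compute_degree!

theorem twoFrequencyPoly_monic (a : ℝ) : (twoFrequencyPoly a).Monic :=
  (monic_X_pow 3).mul ((monic_X_sub_C 1).mul (twoFrequencyPoly_factor_monic.1.mul
    ((monic_X_pow_add_C _ two_ne_zero).pow 3)))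

theorem twoFrequencyPoly_natDegree (a : ℝ) : (twoFrequencyPoly a).natDegree = 12 := by
  have h3 := (monic_X_pow_add_C (a ^ 2) two_ne_zero).pow 3
  have h2 := twoFrequencyPoly_factor_monic.1.mul h3
  have h1 := (monic_X_sub_C (1 : ℝ)).mul h2
  rw [twoFrequencyPoly, (monic_X_pow 3).natDegree_mul h1, (monic_X_sub_C (1 : ℝ)).natDegree_mul h2,
    twoFrequencyPoly_factor_monic.1.natDegree_mul h3,
    (monic_X_pow_add_C (a ^ 2) two_ne_zero).natDegree_pow, natDegree_X_pow_add_C,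
    twoFrequencyPoly_factor_monic.2, natDegree_X_sub_C, natDegree_X_pow]

/-- The polynomial is built from `X` and algebraic constants, so it lifts to the algebraic closure
of ℚ in ℝ. -/
theorem isAlgebraic_coeff_twoFrequencyPoly {a : ℝ} (ha : IsAlgebraic ℚ a) (j : ℕ) :
    IsAlgebraic ℚ ((twoFrequencyPoly a).coeff j) := by
  have h : twoFrequencyPoly a ∈ liftsRing (algebraMap (algebraicClosure ℚ ℝ) ℝ) := by
    have hX : (X : ℝ[X]) ∈ liftsRing (algebraMap (algebraicClosure ℚ ℝ) ℝ) := X_mem_lifts _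
    have hC {b : ℝ} (hb : IsAlgebraic ℚ b) :
        (C b : ℝ[X]) ∈ liftsRing (algebraMap (algebraicClosure ℚ ℝ) ℝ) :=
      C_mem_lifts _ (⟨b, mem_algebraicClosure_iff'.2 hb.isIntegral⟩ : algebraicClosure ℚ ℝ)
    have h2 : IsAlgebraic ℚ (2 : ℝ) := by exact_mod_cast isAlgebraic_natCast (R := ℚ) (A := ℝ) 2
    exact mul_mem (pow_mem hX 3) (mul_mem (sub_mem hX (hC isAlgebraic_one)) (mul_mem
      (add_mem (sub_mem (pow_mem hX 2) (mul_mem (hC h2) hX)) (hC h2))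
      (pow_mem (add_mem (pow_mem hX 2) (hC (ha.pow 2))) 3)))
  obtain ⟨b, hb⟩ := (lifts_iff_coeff_lifts _).1 h j
  rw [← hb]
  exact (mem_algebraicClosure_iff'.1 b.2).isAlgebraic

theorem twoFrequencyPoly_frequencies {a : ℝ} {f : smoothFunctions} {I : Set ℝ} :
    (skolemInstanceOf (twoFrequencyPoly a) f I).frequencies = {0, 1, -1, a, -a} := by
  ext ω
  simp only [SkolemInstance.frequencies, skolemInstanceOf_charPoly (twoFrequencyPoly_monic a),
    Set.mem_ofPred_eq, Set.mem_insert_iff, Set.mem_singleton_iff]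
  have key (z : ℂ) : ((twoFrequencyPoly a).map (algebraMap ℝ ℂ)).IsRoot z ↔
      z = 0 ∨ z = 1 ∨ (z = 1 + Complex.I ∨ z = 1 - Complex.I) ∨
        (z = a * Complex.I ∨ z = -(a * Complex.I)) := by
    have e1 : z ^ 2 - 2 * z + 2 = (z - (1 + Complex.I)) * (z - (1 - Complex.I)) := by
      linear_combination Complex.I_sq
    have e2 : z ^ 2 + (a : ℂ) ^ 2 = (z - a * Complex.I) * (z - -(a * Complex.I)) := by
      linear_combination (a : ℂ) ^ 2 * Complex.I_sq
    simp only [twoFrequencyPoly, IsRoot.def, Polynomial.map_mul, Polynomial.map_pow, map_X,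
      Polynomial.map_sub, Polynomial.map_add, map_C, eval_mul, eval_pow, eval_X, eval_sub, eval_add,
      eval_C, Complex.coe_algebraMap, Complex.ofReal_one, Complex.ofReal_pow, Complex.ofReal_ofNat,
      e1, e2, mul_eq_zero, pow_eq_zero_iff three_ne_zero, sub_eq_zero]
  simp only [key]
  constructor
  · rintro ⟨z, (rfl | rfl | (rfl | rfl) | (rfl | rfl)), rfl⟩ <;> simp
  · rintro (rfl | rfl | rfl | rfl | rfl)
    · exact ⟨0, by simp⟩
    · exact ⟨1 + Complex.I, by simp⟩
    · exact ⟨1 - Complex.I, by simp⟩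
    · exact ⟨ω * Complex.I, by simp⟩
    · exact ⟨-(a * Complex.I), by simp⟩

theorem skolemInstanceOf_hasTwoFrequencies {a : ℝ} (ha : Irrational a) (f : smoothFunctions)
    (I : Set ℝ) : (skolemInstanceOf (twoFrequencyPoly a) f I).HasTwoFrequencies := by
  rw [SkolemInstance.HasTwoFrequencies, twoFrequencyPoly_frequencies]
  have hspan : Submodule.span ℚ ({0, 1, -1, a, -a} : Set ℝ) =
      Submodule.span ℚ (Set.range ![(1 : ℝ), a]) := by
    refine le_antisymm (Submodule.span_le.2 ?_) (Submodule.span_mono ?_)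
    · have h1 : (1 : ℝ) ∈ Submodule.span ℚ (Set.range ![(1 : ℝ), a]) :=
        Submodule.subset_span ⟨0, rfl⟩
      have h2 : a ∈ Submodule.span ℚ (Set.range ![(1 : ℝ), a]) :=
        Submodule.subset_span ⟨1, rfl⟩
      rintro x (rfl | rfl | rfl | rfl | rfl)
      exacts [zero_mem _, h1, neg_mem h1, h2, neg_mem h2]
    · rintro _ ⟨i, rfl⟩
      fin_cases i <;> simp
  have hli : LinearIndependent ℚ ![(1 : ℝ), a] := by
    rw [LinearIndependent.pair_iff' one_ne_zero]
    intro q hq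
    refine ha ⟨q, ?_⟩
    rw [← hq, Rat.smul_def, mul_one]
  rw [hspan, finrank_span_eq_card hli, Fintype.card_fin]

/-! ### From the oracle to approximate comparison -/

/-- An oracle for the Continuous Skolem Problem finds zeros, in varying intervals, of translates by
varying rational constants of a fixed solution. -/
theorem exists_zero_decider {a : ℝ} (ha : Irrational a) (halg : IsAlgebraic ℚ a)
    (hS : SkolemDecidableOn SkolemInstance.HasTwoFrequencies) {f : smoothFunctions}
    (hker : smoothFunctions.op (twoFrequencyPoly a) f = 0)
    (hjet : f ∈ smoothFunctions.algebraicJets) (hf0 : f.1 0 = 0) {α : Type*} [Primcodable α]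
    {s : α → RatCode} {I : α → IntervalCode} (hs : Computable s) (hI : Computable I)
    (hI0 : ∀ x, intervalVal (I x) ⊆ Set.Ici 0) :
    ∃ d : α → Bool, Computable d ∧
      ∀ x, d x = true ↔ ∃ t ∈ intervalVal (I x), f.1 t + (ratVal (s x) : ℝ) = 0 := by
  obtain ⟨S, hSp, hSd⟩ := hS
  set χ := twoFrequencyPoly a
  choose cc hcc using fun j => exists_algCode (isAlgebraic_coeff_twoFrequencyPoly halg j)
  choose ic hic using fun j => exists_algCode (hjet j)
  let g (x : α) : smoothFunctions := f + algebraMap ℝ _ (ratVal (s x) : ℝ)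
  have hg0 (x : α) : (g x).1 0 = ratVal (s x) := by
    change f.1 0 + (ratVal (s x) : ℝ) = _
    rw [hf0, zero_add]
  have hgker (x : α) : smoothFunctions.op χ (g x) = 0 := by
    have h1 : smoothFunctions.op χ (1 : smoothFunctions) = 0 :=
      smoothFunctions.op_eq_zero_of_dvd ((dvd_pow_self X three_ne_zero).mul_right _)
        smoothFunctions.op_one
    simp only [g, map_add, hker, Algebra.algebraMap_eq_smul_one, map_smul, h1, smul_zero, add_zero]
  -- Adding a constant changes only the initial value of order zero; all other codes can be fixed
  -- once and for all.
  have hgD (x : α) (j : ℕ) : iteratedDeriv (j + 1) (g x).1 0 =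
      (((smoothFunctions.D : smoothFunctions →ₗ[ℝ] smoothFunctions) ^ (j + 1)) f).1 0 := by
    rw [← smoothFunctions.coe_D_pow]
    simp only [pow_succ, Module.End.mul_apply, Derivation.coeFn_coe, g, map_add,
      Derivation.map_algebraMap, map_zero, add_zero]
  let tail : List (AlgCode × AlgCode) := List.ofFn fun i : Fin 11 => (cc (i + 1), ic (i + 1))
  let code (x : α) : SkolemCode := ((cc 0, ratAlgCode (s x)) :: tail, I x)
  have hcode : Computable code :=
    Computable.pair (Computable.list_cons.comp
      (Computable.pair (Computable.const _) (primrec_ratAlgCode.to_comp.comp hs))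
      (Computable.const _)) hI
  have hrep (x : α) : (code x).Represents (skolemInstanceOf χ (g x) (intervalVal (I x))) := by
    refine ⟨⟨?_, ?_⟩, rfl, hI0 x⟩
    · simp [code, tail, skolemInstanceOf, χ, twoFrequencyPoly_natDegree]
    · rintro ⟨j, hj⟩
      rcases j with _ | j
      · refine ⟨hcc 0, ?_⟩
        have := ratAlgCode_denotes (s x)
        rwa [← hg0 x] at this
      · have hj' : j < 11 := by
          have : j + 1 < 12 := by simpa [code, tail] using hj
          omega
        have e : (code x).1.get ⟨j + 1, hj⟩ = (cc (j + 1), ic (j + 1)) :=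
          List.getElem_ofFn _
        rw [e]
        refine ⟨hcc (j + 1), ?_⟩
        have := hic (j + 1)
        rwa [← hgD x] at this
  choose d hd hdz using fun x =>
    hSd (code x) _ (hrep x) (skolemInstanceOf_hasTwoFrequencies ha (g x) _)
  refine ⟨d, (hSp.comp hcode).of_eq_tot hd, fun x => ?_⟩
  rw [hdz x, skolemInstanceOf_hasZero_iff (twoFrequencyPoly_monic a) (hgker x)]
  rfl

theorem Computable.exists_least {α : Type*} [Primcodable α] {d : α × ℕ → Bool} (hd : Computable d)
    (h : ∀ x, ∃ k, d (x, k) = true) :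
    ∃ u : α → ℕ, Computable u ∧ ∀ x, d (x, u x) = true ∧ ∀ k < u x, d (x, k) = false := by
  classical
  refine ⟨fun x => Nat.find (h x), ?_, fun x => ⟨Nat.find_spec (h x), fun k hk => ?_⟩⟩
  · have hp : Partrec₂ fun (x : α) (k : ℕ) => (d (x, k) : Part Bool) := hd.partrec.to₂
    refine (Partrec.rfind hp).of_eq_tot fun x => ?_
    refine Nat.mem_rfind.2 ⟨?_, fun {m} hm => ?_⟩
    · rw [Nat.find_spec (h x)]; exact Part.mem_some _
    · rw [Bool.eq_false_iff.2 (Nat.find_min (h x) hm)]; exact Part.mem_some _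
  · exact Bool.eq_false_iff.2 (Nat.find_min (h x) hk)

/-- A nonnegative real number is computable if an algorithm compares it with rational numbers up to
the given accuracy. -/
theorem isComputableReal_of_approx_decider {x : ℝ} (hx : 0 ≤ x) {d : ℕ × ℕ → Bool}
    (hd : Computable d) (htrue : ∀ N k, d (N, k) = true → x ≤ (k + 1 : ℝ) / (N + 1))
    (hfalse : ∀ N k, d (N, k) = false → (k : ℝ) / (N + 1) ≤ x) : IsComputableReal x := by
  have hex (N : ℕ) : ∃ k, d (N, k) = true := by
    obtain ⟨k, hk⟩ := exists_nat_gt (x * (N + 1))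
    refine ⟨k, ?_⟩
    by_contra hne
    have := hfalse N k (Bool.eq_false_iff.2 hne)
    rw [div_le_iff₀ (by positivity)] at this
    linarith
  obtain ⟨u, hu, huspec⟩ := hd.exists_least hex
  refine ⟨fun e => (u (e.2.2 + 1), 0, e.2.2 + 1), ?_, ?_⟩
  · have hr : Computable fun e : RatCode => e.2.2 + 1 :=
      Computable.succ.comp (Computable.snd.comp Computable.snd)
    exact Computable.pair (hu.comp hr) (Computable.pair (Computable.const 0) hr)
  · rintro ⟨p, q, r⟩ he
    have hr : (0 : ℝ) < r + 1 := by positivity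
    have hpq : (1 : ℝ) / (r + 1) ≤ (ratVal (p, q, r) : ℝ) := by
      have h1 : (0 : ℚ) < (p : ℚ) - q := by
        have hr' : (0 : ℚ) < (r : ℚ) + 1 := by positivity
        simp only [ratVal] at he
        exact (div_pos_iff_of_pos_right hr').1 he
      have h2 : q + 1 ≤ p := by
        have : (q : ℚ) < p := by linarith
        exact_mod_cast this
      have h3 : (q : ℝ) + 1 ≤ p := by exact_mod_cast h2
      simp only [ratVal]
      push_cast
      gcongr
      linarith
    refine lt_of_lt_of_le ?_ hpq
    -- A positive rational with code (p, q, r) is at least 1 / (r + 1). Searching with denominator r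
    -- + 2 gives error at most 1 / (r + 2), hence the strict inequality.
    obtain ⟨h1, h2⟩ := huspec (r + 1)
    have hval : (ratVal (u (r + 1), 0, r + 1) : ℝ) = u (r + 1) / ((r : ℝ) + 2) := by
      simp only [ratVal]
      push_cast
      congr 1
      · ring
      · ring
    have hR : (0 : ℝ) < r + 2 := by positivity
    have hup := htrue _ _ h1
    have hlow : (u (r + 1) : ℝ) - 1 ≤ x * (r + 2) := by
      rcases hk : u (r + 1) with _ | k
      · have : 0 ≤ x * ((r : ℝ) + 2) := by positivity
        push_cast
        linarith
      · have := hfalse _ _ (h2 k (by omega))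
        rw [div_le_iff₀ (by positivity)] at this
        push_cast at this ⊢
        linarith
    have hup' : x * (r + 2) ≤ u (r + 1) + 1 := by
      rw [le_div_iff₀ (by positivity)] at hup
      push_cast at hup
      linarith
    have habs : |(u (r + 1) : ℝ) / (r + 2) - x| ≤ 1 / (r + 2) := by
      rw [abs_le, ← neg_div]
      constructor
      · rw [div_le_iff₀ hR, sub_mul, div_mul_cancel₀ _ hR.ne']
        linarith
      · rw [le_div_iff₀ hR, sub_mul, div_mul_cancel₀ _ hR.ne']
        linarith
    rw [hval]
    refine habs.trans_lt ?_
    exact one_div_lt_one_div_of_lt hr (by linarith)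

theorem isComputableReal_zero : IsComputableReal 0 :=
  isComputableReal_of_approx_decider le_rfl (d := fun _ => true) (Computable.const _)
    (fun N k _ => by positivity) (fun N k h => by simp at h)

/-- The code of the interval `(0, k / (N + 1)]`. -/
def IocCode (x : ℕ × ℕ) : IntervalCode := (((0, 0, 0), false), some ((x.2, 0, x.1), true))

theorem primrec_IocCode : Primrec IocCode := by
  unfold IocCode
  exact Primrec.pair (Primrec.const _) (Primrec.option_some.comp (Primrec.pair
    (Primrec.pair Primrec.snd (Primrec.pair (Primrec.const 0) Primrec.fst)) (Primrec.const true)))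

theorem intervalVal_IocCode (x : ℕ × ℕ) :
    intervalVal (IocCode x) = Set.Ioc 0 ((x.2 : ℝ) / (x.1 + 1)) := by
  simp [IocCode, intervalVal, ratVal]

/-! ### Computing algebraic numbers and π with the oracle -/

/-- An oracle for the Continuous Skolem Problem locates the least positive zero of a solution. -/
theorem exists_least_zero_decider {a : ℝ} (ha : Irrational a) (halg : IsAlgebraic ℚ a)
    (hS : SkolemDecidableOn SkolemInstance.HasTwoFrequencies) {f : smoothFunctions}
    (hker : smoothFunctions.op (twoFrequencyPoly a) f = 0)
    (hjet : f ∈ smoothFunctions.algebraicJets) (hf0 : f.1 0 = 0) {ρ : ℝ} (hρ0 : 0 < ρ)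
    (hρ : f.1 ρ = 0) (hmin : ∀ t, 0 < t → f.1 t = 0 → ρ ≤ t) :
    ∃ d : ℕ × ℕ → Bool, Computable d ∧ ∀ N k, d (N, k) = true ↔ ρ ≤ (k : ℝ) / (N + 1) := by
  obtain ⟨d, hd, h⟩ := exists_zero_decider ha halg hS hker hjet hf0 (α := ℕ × ℕ)
    (s := fun _ => (0, 0, 0)) (I := IocCode) (Computable.const _) primrec_IocCode.to_comp
    (fun x => by rw [intervalVal_IocCode]; exact fun t ht => ht.1.le)
  refine ⟨d, hd, fun N k => ?_⟩
  have h0 : (ratVal (0, 0, 0) : ℝ) = 0 := by simp [ratVal]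
  simp only [h, intervalVal_IocCode, h0, add_zero]
  constructor
  · rintro ⟨t, ⟨ht0, ht1⟩, ht⟩
    exact (hmin t ht0 ht).trans ht1
  · intro hle
    exact ⟨ρ, ⟨hρ0, hle⟩, hρ⟩

open smoothFunctions in
theorem op_twoFrequencyPoly_t (a : ℝ) :
    op (twoFrequencyPoly a) t = 0 ∧ op (twoFrequencyPoly a) (t * t) = 0 := by
  have h1 : op (X ^ 1) (1 : smoothFunctions) = 0 := by rw [pow_one, op_one]
  have h2 := op_pow_t_mul h1
  have h3 := op_pow_t_mul h2
  rw [mul_one] at h2 h3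
  have hd : X ^ 3 ∣ twoFrequencyPoly a := dvd_mul_right _ _
  exact ⟨op_eq_zero_of_dvd ((pow_dvd_pow X (by norm_num)).trans hd) h2, op_eq_zero_of_dvd hd h3⟩

open smoothFunctions in
-- The polynomial t² - xt solves the common equation, vanishes at 0, and has x as its only positive
-- zero.
theorem isComputableReal_of_isAlgebraic {a : ℝ} (ha : Irrational a) (halg : IsAlgebraic ℚ a)
    (hS : SkolemDecidableOn SkolemInstance.HasTwoFrequencies) {x : ℝ}
    (hx0 : 0 < x) (hx : IsAlgebraic ℚ x) :
    IsComputableReal x := by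
  have hval (s : ℝ) : (t * t - x • t : smoothFunctions).1 s = s * s - x * s := rfl
  have key : ∃ d : ℕ × ℕ → Bool, Computable d ∧ ∀ N k, d (N, k) = true ↔ x ≤ (k : ℝ) / (N + 1) := by
    refine exists_least_zero_decider ha halg hS (f := t * t - x • t) ?_ ?_ ?_ hx0 ?_ ?_
    · rw [map_sub, map_smul, (op_twoFrequencyPoly_t a).1, (op_twoFrequencyPoly_t a).2, smul_zero,
        sub_zero]
    · exact sub_mem (mul_mem t_mem_algebraicJets t_mem_algebraicJets)
        (smul_mem_algebraicJets hx t_mem_algebraicJets)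
    · rw [hval]; ring
    · rw [hval]; ring
    · intro s hs h0
      rw [hval, ← sub_mul, mul_eq_zero] at h0
      rcases h0 with h0 | h0 <;> linarith
  obtain ⟨d, hd, h⟩ := key
  refine isComputableReal_of_approx_decider hx0.le hd (fun N k hk => ?_) (fun N k hk => ?_)
  · refine ((h N k).1 hk).trans ?_
    gcongr
    linarith
  · by_contra hlt
    rw [(h N k).2 (not_le.1 hlt).le] at hk
    exact Bool.noConfusion hk

open smoothFunctions in
-- The least positive zero of e^t sin t is π; the exponential factor makes it a solution of the
-- common equation.
theorem exists_pi_decider {a : ℝ} (ha : Irrational a) (halg : IsAlgebraic ℚ a)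
    (hS : SkolemDecidableOn SkolemInstance.HasTwoFrequencies) :
    ∃ d : ℕ × ℕ → Bool, Computable d ∧
      ∀ N k, d (N, k) = true ↔ Real.pi ≤ (k : ℝ) / (N + 1) := by
  have hval (s : ℝ) : (exp * sin 1 : smoothFunctions).1 s = Real.exp s * Real.sin (1 * s) := rfl
  refine exists_least_zero_decider ha halg hS (f := exp * sin 1) ?_ ?_ ?_ Real.pi_pos ?_ ?_
  · exact op_eq_zero_of_dvd (((dvd_mul_right _ _).mul_left _).mul_left _) op_exp_mul_sin_one
  · exact mul_mem exp_mem_algebraicJets (cos_sin_mem_algebraicJets isAlgebraic_one).2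
  · rw [hval]; simp
  · rw [hval]; simp
  · intro s hs h0
    rw [hval, one_mul, mul_eq_zero, or_iff_right (Real.exp_ne_zero s)] at h0
    by_contra hlt
    exact (Real.sin_pos_of_pos_of_lt_pi hs (not_le.1 hlt)).ne' h0

/-! ### The approximation function and the threshold query -/

/-- A solution whose values at large `2 * π * m` measure how well `a` is approximated by fractions
with denominator `m`. -/
noncomputable def approxFunction (a : ℝ) : smoothFunctions :=
  (smoothFunctions.exp - smoothFunctions.exp * smoothFunctions.cos 1) +
    (smoothFunctions.t * (smoothFunctions.t * (1 - smoothFunctions.cos a)) +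
      (3 : ℝ) • (smoothFunctions.t * (1 - smoothFunctions.cos a)))

theorem approxFunction_apply (a s : ℝ) : (approxFunction a).1 s =
    Real.exp s * (1 - Real.cos s) + (s ^ 2 + 3 * s) * (1 - Real.cos (a * s)) := by
  have : (approxFunction a).1 s = (Real.exp s - Real.exp s * Real.cos (1 * s)) +
    (s * (s * (1 - Real.cos (a * s))) + 3 * (s * (1 - Real.cos (a * s)))) := rfl
  rw [this, one_mul]
  ring

open smoothFunctions in
theorem op_approxFunction (a : ℝ) : op (twoFrequencyPoly a) (approxFunction a) = 0 := by
  obtain ⟨e3, e4⟩ := op_twoFrequencyPoly_t a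
  have hc : op ((X ^ 2 + C (a ^ 2)) ^ 1) (cos a) = 0 := by rw [pow_one, op_cos]
  have hc2 := op_pow_t_mul hc
  have hc3 := op_pow_t_mul hc2
  have d2 : (X ^ 2 + C (a ^ 2)) ^ 3 ∣ twoFrequencyPoly a :=
    ((dvd_mul_left _ _).mul_left _).mul_left _
  have e1 : op (twoFrequencyPoly a) exp = 0 :=
    op_eq_zero_of_dvd ((dvd_mul_right _ _).mul_left _) op_exp
  have e2 : op (twoFrequencyPoly a) (exp * cos 1) = 0 :=
    op_eq_zero_of_dvd (((dvd_mul_right _ _).mul_left _).mul_left _) op_exp_mul_cos_one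
  have e5 : op (twoFrequencyPoly a) (t * cos a) = 0 :=
    op_eq_zero_of_dvd ((pow_dvd_pow _ (by norm_num)).trans d2) hc2
  have e6 : op (twoFrequencyPoly a) (t * (t * cos a)) = 0 := op_eq_zero_of_dvd d2 hc3
  simp only [approxFunction, mul_sub, mul_one, map_add, map_sub, map_smul, e1, e2, e3, e4, e5, e6,
    sub_zero, add_zero, smul_zero]

open smoothFunctions in
theorem approxFunction_mem_algebraicJets {a : ℝ} (ha : IsAlgebraic ℚ a) :
    approxFunction a ∈ algebraicJets := by
  have h3 : IsAlgebraic ℚ (3 : ℝ) := by exact_mod_cast isAlgebraic_natCast (R := ℚ) (A := ℝ) 3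
  have hc := sub_mem (one_mem _) (cos_sin_mem_algebraicJets ha).1
  have ht := mul_mem t_mem_algebraicJets hc
  exact add_mem (sub_mem exp_mem_algebraicJets (mul_mem exp_mem_algebraicJets
    (cos_sin_mem_algebraicJets isAlgebraic_one).1))
    (add_mem (mul_mem t_mem_algebraicJets ht) (smul_mem_algebraicJets h3 ht))

/-- The code of the interval `[T, ∞)`. -/
def IciCode (T : ℕ) : IntervalCode := (((T, 0, 0), true), none)

theorem intervalVal_IciCode (T : ℕ) : intervalVal (IciCode T) = Set.Ici (T : ℝ) := by
  simp [IciCode, intervalVal, ratVal]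

/-- A number `x` is computable if `8 * π ^ 4 * x ^ 2` is the infimum of the values of
`approxFunction a` at large arguments, and no other value is skipped there. -/
theorem isComputableReal_of_approxFunction_threshold {a : ℝ} (ha : Irrational a)
    (halg : IsAlgebraic ℚ a) (hS : SkolemDecidableOn SkolemInstance.HasTwoFrequencies) {x : ℝ}
    (hx : 0 ≤ x) {T : ℕ}
    (hlow : ∀ t : ℝ, T ≤ t → 8 * Real.pi ^ 4 * x ^ 2 ≤ (approxFunction a).1 t)
    (hmem : ∀ c : ℝ, 8 * Real.pi ^ 4 * x ^ 2 < c → ∃ t : ℝ, T ≤ t ∧ (approxFunction a).1 t = c) :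
    IsComputableReal x := by
  obtain ⟨dπ, hdπ, hπ⟩ := exists_pi_decider ha halg hS
  have hex (N : ℕ) : ∃ k, dπ (N, k) = true := by
    obtain ⟨k, hk⟩ := exists_nat_gt (Real.pi * (N + 1))
    exact ⟨k, (hπ N k).2 ((le_div_iff₀ (by positivity)).2 hk.le)⟩
  obtain ⟨u, hu, huspec⟩ := hdπ.exists_least hex
  have hu1 (k : ℕ) : Real.pi * (k + 1) ≤ u k := by
    have := (hπ k _).1 (huspec k).1
    rwa [le_div_iff₀ (by positivity)] at this
  have hu2 (k : ℕ) : (u k : ℝ) ≤ Real.pi * (k + 1) + 1 := by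
    rcases hk : u k with _ | m
    · push_cast; positivity
    · have h1 := (huspec k).2 m (by omega)
      have h2 : ¬ Real.pi ≤ (m : ℝ) / (k + 1) := by rw [← hπ, h1]; simp
      rw [le_div_iff₀ (by positivity)] at h2
      push_cast
      linarith
  -- At p = (N, k) this encodes -8 (u k / (k + 1))⁴ (k / (N + 1))², where u k / (k + 1) approximates
  -- π from above. The final - 1 compensates for the denominator r + 1 in `ratVal`.
  let s (p : ℕ × ℕ) : RatCode :=
    (0, 8 * u p.2 ^ 4 * p.2 ^ 2, (p.2 + 1) ^ 4 * (p.1 + 1) ^ 2 - 1)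
  have hpow (n : ℕ) : Primrec fun m : ℕ => m ^ n := by
    induction n with
    | zero => exact Primrec.const 1
    | succ n ih => exact Primrec.nat_mul.comp ih Primrec.id
  have hs : Computable s := by
    have hk : Primrec fun p : ℕ × ℕ => p.2 := Primrec.snd
    have hmul := Primrec.nat_mul.to_comp
    refine Computable.pair (Computable.const 0) (Computable.pair ?_ ?_)
    · exact hmul.comp (hmul.comp (Computable.const 8)
        ((hpow 4).to_comp.comp (hu.comp hk.to_comp))) ((hpow 2).comp hk).to_comp
    · exact (Primrec.nat_sub.comp (Primrec.nat_mul.comp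
        ((hpow 4).comp (Primrec.succ.comp Primrec.snd))
        ((hpow 2).comp (Primrec.succ.comp Primrec.fst))) (Primrec.const 1)).to_comp
  have hsval (N k : ℕ) : (ratVal (s (N, k)) : ℝ) =
      - (8 * u k ^ 4 * k ^ 2 / ((k + 1) ^ 4 * (N + 1) ^ 2)) := by
    have : (((k + 1) ^ 4 * (N + 1) ^ 2 - 1 : ℕ) : ℝ) + 1 = (k + 1) ^ 4 * (N + 1) ^ 2 := by
      have h : (k + 1) ^ 4 * (N + 1) ^ 2 - 1 + 1 = (k + 1) ^ 4 * (N + 1) ^ 2 :=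
        Nat.sub_add_cancel (Nat.succ_le_of_lt (by positivity))
      exact_mod_cast h
    simp only [ratVal, s]
    push_cast
    rw [this]
    ring
  obtain ⟨d, hd, h⟩ := exists_zero_decider ha halg hS (op_approxFunction a)
    (approxFunction_mem_algebraicJets halg) (by rw [approxFunction_apply]; simp) (α := ℕ × ℕ)
    (s := s) (I := fun _ => IciCode T) hs (Computable.const _)
    (fun _ => by
      rw [intervalVal_IciCode]
      exact Set.Ici_subset_Ici.2 (Nat.cast_nonneg T))
  simp only [intervalVal_IciCode, Set.mem_Ici, Prod.forall, hsval] at h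
  have hsq {y z : ℝ} (hy : 0 ≤ y) (hz : 0 ≤ z) (hyz : 8 * Real.pi ^ 4 * y ^ 2 ≤
      8 * Real.pi ^ 4 * z ^ 2) : y ≤ z := by
    have : 0 < 8 * Real.pi ^ 4 := by positivity
    exact (pow_le_pow_iff_left₀ hy hz two_ne_zero).1 (le_of_mul_le_mul_left hyz this)
  refine isComputableReal_of_approx_decider hx hd (fun N k hk => ?_) (fun N k hk => ?_)
  · obtain ⟨t, hT, ht⟩ := (h N k).1 hk
    refine hsq hx (by positivity) ((hlow t hT).trans ?_)
    rw [← sub_eq_add_neg, sub_eq_zero] at ht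
    rw [ht]
    have hu0 : (0 : ℝ) ≤ u k := Nat.cast_nonneg _
    have hk1 : (0 : ℝ) < k + 1 := by positivity
    -- The error in approximating π by u k / (k + 1) costs no more than replacing k by k + 1, which
    -- the approximate comparison allows.
    have h1 : (u k : ℝ) ^ 2 * k ≤ Real.pi ^ 2 * (k + 1) ^ 3 := by
      have h3 := Real.pi_gt_three
      have hk0 : (0 : ℝ) ≤ k := Nat.cast_nonneg _
      have h2 : (u k : ℝ) ^ 2 ≤ (Real.pi * (k + 1) + 1) ^ 2 := by
        gcongr; exact hu2 k
      have h4 : (Real.pi * (k + 1) + 1) ^ 2 * k ≤ Real.pi ^ 2 * (k + 1) ^ 3 := by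
        have e : Real.pi ^ 2 * (k + 1) ^ 3 - (Real.pi * (k + 1) + 1) ^ 2 * k =
          (Real.pi * (Real.pi - 2)) * k ^ 2 + (2 * (Real.pi * (Real.pi - 1)) - 1) * k +
            Real.pi ^ 2 := by ring
        have p1 : 0 ≤ Real.pi * (Real.pi - 2) := by nlinarith
        have p2 : 0 ≤ 2 * (Real.pi * (Real.pi - 1)) - 1 := by nlinarith
        have : 0 ≤ (Real.pi * (Real.pi - 2)) * (k : ℝ) ^ 2 +
          (2 * (Real.pi * (Real.pi - 1)) - 1) * k + Real.pi ^ 2 := by positivity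
        linarith
      exact (mul_le_mul_of_nonneg_right h2 hk0).trans h4
    have h2 : ((u k : ℝ) ^ 2 * k) ^ 2 ≤ (Real.pi ^ 2 * (k + 1) ^ 3) ^ 2 := by
      gcongr
    rw [div_pow, mul_div_assoc', div_le_div_iff₀ (by positivity) (by positivity)]
    calc 8 * (u k : ℝ) ^ 4 * k ^ 2 * (N + 1) ^ 2
        = 8 * ((u k : ℝ) ^ 2 * k) ^ 2 * (N + 1) ^ 2 := by ring
      _ ≤ 8 * (Real.pi ^ 2 * (k + 1) ^ 3) ^ 2 * (N + 1) ^ 2 := by gcongr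
      _ = _ := by ring
  · refine hsq (by positivity) hx ?_
    by_contra hlt
    rw [not_le] at hlt
    have hc : 8 * Real.pi ^ 4 * ((k : ℝ) / (N + 1)) ^ 2 ≤
        8 * u k ^ 4 * k ^ 2 / ((k + 1) ^ 4 * (N + 1) ^ 2) := by
      rw [div_pow, mul_div_assoc', div_le_div_iff₀ (by positivity) (by positivity)]
      have h4 : (Real.pi * (k + 1)) ^ 4 ≤ (u k : ℝ) ^ 4 := by
        gcongr; exact hu1 k
      calc 8 * Real.pi ^ 4 * (k : ℝ) ^ 2 * ((k + 1) ^ 4 * (N + 1) ^ 2)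
          = 8 * (Real.pi * (k + 1)) ^ 4 * k ^ 2 * (N + 1) ^ 2 := by ring
        _ ≤ _ := by gcongr
    obtain ⟨t, hT, ht⟩ := hmem _ (hlt.trans_le hc)
    have : d (N, k) = true := (h N k).2 ⟨t, hT, by rw [ht]; ring⟩
    rw [this] at hk
    exact Bool.noConfusion hk

/-! ### Elementary properties of the type -/

theorem diophantineType_bddBelow (a : ℝ) :
    ∀ c ∈ {c : ℝ | ∃ m n : ℤ, m ≠ 0 ∧ |a - (n : ℝ) / (m : ℝ)| < c / (m : ℝ) ^ 2}, 0 ≤ c := by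
  rintro c ⟨m, n, hm, h⟩
  have hm' : (0 : ℝ) < (m : ℝ) ^ 2 := by positivity
  exact ((div_pos_iff_of_pos_right hm').1 ((abs_nonneg _).trans_lt h)).le

theorem diophantineType_nonneg (a : ℝ) : 0 ≤ diophantineType a :=
  Real.sInf_nonneg (diophantineType_bddBelow a)

theorem abs_sub_div_lt_div_sq_iff {a : ℝ} {m : ℝ} (hm : m ≠ 0) (n c : ℝ) :
    |a - n / m| < c / m ^ 2 ↔ |m| * |m * a - n| < c := by
  rw [lt_div_iff₀ (by positivity)]
  have : |a - n / m| * m ^ 2 = |m| * |m * a - n| := by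
    have e : m * a - n = m * (a - n / m) := by field_simp
    rw [e, abs_mul, ← sq_abs m]
    ring
  rw [this]

theorem diophantineType_le {a : ℝ} {m : ℤ} (hm : m ≠ 0) (n : ℤ) :
    diophantineType a ≤ |(m : ℝ)| * |m * a - n| := by
  refine le_of_forall_pos_le_add fun ε hε => csInf_le ⟨0, diophantineType_bddBelow a⟩ ⟨m, n, hm, ?_⟩
  rw [abs_sub_div_lt_div_sq_iff (Int.cast_ne_zero.2 hm)]
  linarith

theorem exists_lt_of_diophantineType_lt {a c : ℝ} (h : diophantineType a < c) :
    ∃ m n : ℤ, 0 < m ∧ (m : ℝ) * |m * a - n| < c := by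
  have hne : {c : ℝ | ∃ m n : ℤ, m ≠ 0 ∧ |a - (n : ℝ) / (m : ℝ)| < c / (m : ℝ) ^ 2}.Nonempty :=
    ⟨|a| + 1, 1, 0, one_ne_zero, by simp⟩
  obtain ⟨b, ⟨m, n, hm, hb⟩, hbc⟩ := exists_lt_of_csInf_lt hne h
  rw [abs_sub_div_lt_div_sq_iff (Int.cast_ne_zero.2 hm)] at hb
  rcases lt_or_gt_of_ne hm with hneg | hpos
  · refine ⟨-m, -n, by omega, ?_⟩
    have hm' : (m : ℝ) < 0 := by exact_mod_cast hneg
    rw [abs_of_neg hm', abs_sub_comm] at hb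
    push_cast
    have : -(m : ℝ) * a - -(n : ℝ) = n - m * a := by ring
    rw [this]
    exact hb.trans hbc
  · have hm' : (0 : ℝ) < m := by exact_mod_cast hpos
    rw [abs_of_pos hm'] at hb
    exact ⟨m, n, hpos, hb.trans hbc⟩

theorem diophantineType_ratCast (q : ℚ) : diophantineType q = 0 := by
  refine le_antisymm ?_ (diophantineType_nonneg _)
  refine (diophantineType_le (m := q.den) (by exact_mod_cast q.den_nz) q.num).trans_eq ?_
  have : ((q.den : ℤ) : ℝ) * (q : ℝ) - q.num = 0 := by
    have := q.den_mul_eq_num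
    rw [sub_eq_zero]
    exact_mod_cast this
  rw [this, abs_zero, mul_zero]

/-- If the type is not attained, then it is approached with arbitrarily large denominators. -/
theorem exists_large_lt_of_not_attained {a c : ℝ}
    (hna : ∀ m n : ℤ, 0 < m → (m : ℝ) * |m * a - n| ≠ diophantineType a)
    (h : diophantineType a < c) (M : ℕ) : ∃ m n : ℤ, M ≤ m ∧ 0 < m ∧ (m : ℝ) * |m * a - n| < c := by
  -- For each denominator, rounding gives the best numerator, which misses the type by a positive
  -- amount; only finitely many denominators lie below M.
  have hgap : ∃ ε > 0, ∀ m n : ℤ, 0 < m → m < M → diophantineType a + ε ≤ m * |m * a - n| := by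
    induction M with
    | zero => exact ⟨1, one_pos, fun m n h0 h1 => by push_cast at h1; omega⟩
    | succ M ih =>
      obtain ⟨ε, hε, hM⟩ := ih
      rcases Nat.eq_zero_or_pos M with rfl | hpos
      · exact ⟨1, one_pos, fun m n h0 h1 => by push_cast at h1; omega⟩
      have hMr : (0 : ℝ) < M := by exact_mod_cast hpos
      have hlt : diophantineType a < M * |M * a - round (M * a)| := by
        refine lt_of_le_of_ne ?_ (Ne.symm ?_)
        · have := diophantineType_le (a := a) (m := M) (by omega) (round (M * a))
          rwa [Int.cast_natCast, abs_of_pos hMr] at this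
        · have := hna M (round (M * a)) (by exact_mod_cast hpos)
          rwa [Int.cast_natCast] at this
      refine ⟨min ε (M * |M * a - round (M * a)| - diophantineType a),
        lt_min hε (sub_pos.2 hlt), fun m n h0 h1 => ?_⟩
      rcases (show m < M ∨ m = M by push_cast at h1; omega) with h2 | rfl
      · exact (add_le_add_right (min_le_left _ _) _).trans (hM m n h0 h2)
      · rw [Int.cast_natCast]
        have h3 := mul_le_mul_of_nonneg_left (round_le ((M : ℝ) * a) n) hMr.le
        have h4 := min_le_right ε (M * |M * a - round (M * a)| - diophantineType a)
        linarith
  obtain ⟨ε, hε, hgap⟩ := hgap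
  obtain ⟨m, n, hm, hlt⟩ := exists_lt_of_diophantineType_lt
    (lt_min h (lt_add_of_pos_right (diophantineType a) hε))
  refine ⟨m, n, ?_, hm, hlt.trans_le (min_le_left _ _)⟩
  by_contra hM
  exact absurd (hlt.trans_le (min_le_right _ _)) (not_lt.2 (hgap m n hm (not_le.1 hM)))

/-! ### Values of the approximation function at large arguments -/

/-- The values of `approxFunction a` come close to `8 * π ^ 4 * (diophantineType a) ^ 2`. -/
theorem exists_approxFunction_eq {a : ℝ}
    (hna : ∀ m n : ℤ, 0 < m → (m : ℝ) * |m * a - n| ≠ diophantineType a) (T : ℕ) {c : ℝ}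
    (hc : 8 * Real.pi ^ 4 * diophantineType a ^ 2 < c) :
    ∃ t : ℝ, T ≤ t ∧ (approxFunction a).1 t = c := by
  set L := diophantineType a
  have hL : 0 ≤ L := diophantineType_nonneg a
  have hπ := Real.pi_pos
  have hπ3 := Real.pi_gt_three
  have h8 : 0 < 8 * Real.pi ^ 4 := by positivity
  obtain ⟨K, hLK, hK⟩ := exists_between ((Real.lt_sqrt hL).2 ((lt_div_iff₀' h8).2 hc))
  have hK0 : 0 < K := hL.trans_lt hLK
  rw [Real.lt_sqrt hK0.le, lt_div_iff₀' h8] at hK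
  set g := c - 8 * Real.pi ^ 4 * K ^ 2 with hg
  have hg0 : 0 < g := sub_pos.2 hK
  -- The three bounds put t beyond T, make the exponential exceed c, and keep the contribution of
  -- the term 3t at t = 2πm within the slack g.
  obtain ⟨M, hM⟩ := exists_nat_ge (max (max (T : ℝ) c) (12 * Real.pi ^ 3 * K ^ 2 / g))
  obtain ⟨m, n, hMm, hm, hlt⟩ := exists_large_lt_of_not_attained hna hLK M
  have hm' : (0 : ℝ) < m := by exact_mod_cast hm
  have hMm' : (M : ℝ) ≤ m := by exact_mod_cast hMm
  have hTm : (T : ℝ) ≤ m := ((le_max_left _ _).trans (le_max_left _ _)).trans (hM.trans hMm')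
  have hcm : c ≤ m := ((le_max_right _ _).trans (le_max_left _ _)).trans (hM.trans hMm')
  have hgm : 12 * Real.pi ^ 3 * K ^ 2 ≤ g * m := by
    rw [← div_le_iff₀' hg0]
    exact (le_max_right _ _).trans (hM.trans hMm')
  set t : ℝ := m * (2 * Real.pi) with ht
  have hmt : (m : ℝ) ≤ t := by rw [ht]; nlinarith
  have hlow : (approxFunction a).1 t ≤ c := by
    set e := |m * a - n| with he
    have he0 : 0 ≤ e := abs_nonneg _
    have hcos : Real.cos t = 1 := Real.cos_int_mul_two_pi m
    have hcosa : 1 - Real.cos (a * t) ≤ 2 * Real.pi ^ 2 * e ^ 2 := by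
      have h1 : Real.cos (a * t) = Real.cos (2 * Real.pi * (m * a - n)) := by
        rw [← Real.cos_sub_int_mul_two_pi (a * t) n]
        congr 1
        rw [ht]; ring
      have h2 := Real.one_sub_sq_div_two_le_cos (x := 2 * Real.pi * (m * a - n))
      rw [h1, he, sq_abs]
      linarith
    rw [approxFunction_apply, hcos, sub_self, mul_zero, zero_add]
    have h1 : (m * e) ^ 2 ≤ K ^ 2 := by gcongr
    have h2 : 12 * Real.pi ^ 3 * (m * e) ^ 2 ≤ g * m := le_trans (by gcongr) hgm
    have h3 : 12 * Real.pi ^ 3 * (m * e ^ 2) ≤ g := by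
      refine le_of_mul_le_mul_right ?_ hm'
      calc _ = 12 * Real.pi ^ 3 * (m * e) ^ 2 := by ring
        _ ≤ _ := h2
    calc (t ^ 2 + 3 * t) * (1 - Real.cos (a * t))
        ≤ (t ^ 2 + 3 * t) * (2 * Real.pi ^ 2 * e ^ 2) := by gcongr
      _ = 8 * Real.pi ^ 4 * (m * e) ^ 2 + 12 * Real.pi ^ 3 * (m * e ^ 2) := by rw [ht]; ring
      _ ≤ 8 * Real.pi ^ 4 * K ^ 2 + g := by gcongr
      _ = c := by rw [hg]; ring
  -- Half a period later the first summand is twice the exponential, so the value c is crossed in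
  -- between.
  have hhigh : c ≤ (approxFunction a).1 (t + Real.pi) := by
    have hcos : Real.cos (t + Real.pi) = -1 := by
      rw [Real.cos_add_pi, Real.cos_int_mul_two_pi m]
    rw [approxFunction_apply, hcos]
    have h1 := Real.add_one_le_exp (t + Real.pi)
    have h2 : 0 ≤ ((t + Real.pi) ^ 2 + 3 * (t + Real.pi)) * (1 - Real.cos (a * (t + Real.pi))) :=
      mul_nonneg (by positivity) (sub_nonneg.2 (Real.cos_le_one _))
    linarith
  obtain ⟨s, hs, hsc⟩ := intermediate_value_Icc (le_add_of_nonneg_right hπ.le)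
    (smoothFunctions.differentiable (approxFunction a)).continuous.continuousOn ⟨hlow, hhigh⟩
  exact ⟨s, hTm.trans (hmt.trans hs.1), hsc⟩

/-- Reduction of an argument to a period of the cosine. -/
theorem exists_eq_int_mul_two_pi_add (x : ℝ) :
    ∃ (n : ℤ) (r : ℝ), x = n * (2 * Real.pi) + r ∧ Real.cos r = Real.cos x ∧
      2 / Real.pi ^ 2 * r ^ 2 ≤ 1 - Real.cos x := by
  have hπ := Real.pi_pos
  have h1 : |x - round (x / (2 * Real.pi)) * (2 * Real.pi)| ≤ Real.pi := by
    have h := abs_sub_round (x / (2 * Real.pi))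
    have e : x - round (x / (2 * Real.pi)) * (2 * Real.pi) =
        (x / (2 * Real.pi) - round (x / (2 * Real.pi))) * (2 * Real.pi) := by field_simp
    rw [e, abs_mul, abs_of_pos (by positivity : 0 < 2 * Real.pi)]
    nlinarith
  refine ⟨round (x / (2 * Real.pi)), _, (add_sub_cancel _ x).symm, Real.cos_sub_int_mul_two_pi _ _, ?_⟩
  have h2 := Real.cos_le_one_sub_mul_cos_sq h1
  rw [Real.cos_sub_int_mul_two_pi] at h2
  linarith

open Filter Topology in
-- For L > 0, a smaller value at a large t would give t = 2πm + η and at = 2πn + δ with η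
-- exponentially small and δ so small that m|ma - n| < L. The term 3t makes the bound exact: it
-- absorbs the quartic error of the cosine and the discrepancy between t and 2πm.
theorem exists_approxFunction_ge {a : ℝ} (ha : 0 < a) :
    ∃ T : ℕ, ∀ t : ℝ, T ≤ t →
      8 * Real.pi ^ 4 * diophantineType a ^ 2 ≤ (approxFunction a).1 t := by
  set L := diophantineType a with hLdef
  have hL : 0 ≤ L := diophantineType_nonneg a
  have hπ := Real.pi_pos
  have hπ3 := Real.pi_gt_three
  set B := 8 * Real.pi ^ 4 * L ^ 2 with hB
  have hpos {t : ℝ} (ht : 0 ≤ t) : 0 ≤ Real.exp t * (1 - Real.cos t) ∧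
      0 ≤ (t ^ 2 + 3 * t) * (1 - Real.cos (a * t)) :=
    ⟨mul_nonneg (Real.exp_pos t).le (sub_nonneg.2 (Real.cos_le_one _)),
      mul_nonneg (by positivity) (sub_nonneg.2 (Real.cos_le_one _))⟩
  rcases hL.eq_or_lt with hL0 | hL0
  · refine ⟨0, fun t ht => ?_⟩
    rw [hB, ← hL0, approxFunction_apply]
    have := hpos (by simpa using ht)
    simp only [ne_eq, OfNat.ofNat_ne_zero, not_false_eq_true, zero_pow, mul_zero]
    linarith
  clear_value B
  obtain ⟨C, hC⟩ : ∃ C, C = B * Real.pi ^ 2 / 2 := ⟨_, rfl⟩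
  have hC0 : 0 ≤ C := by rw [hC, hB]; positivity
  -- The number κ will bound |η| t². The last condition gives 4aκ ≤ 2π²L, exactly what the
  -- concluding inequality can absorb.
  obtain ⟨κ, hκ0, hκ1, hκ2⟩ : ∃ κ, 0 < κ ∧ κ ≤ 1 / 2 ∧ κ ≤ Real.pi ^ 2 * L / (2 * a) :=
    ⟨_, lt_min one_half_pos (by positivity), min_le_left _ _, min_le_right _ _⟩
  rw [le_div_iff₀ (by positivity)] at hκ2
  have hlim : ∀ᶠ t : ℝ in atTop, C * (t ^ 4 * Real.exp (-t)) < κ ^ 2 := by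
    have h := (Real.tendsto_pow_mul_exp_neg_atTop_nhds_zero 4).const_mul C
    rw [mul_zero] at h
    exact h.eventually_lt_const (by positivity)
  obtain ⟨T, hT⟩ := eventually_atTop.1
    ((tendsto_natCast_atTop_atTop (R := ℝ)).eventually (eventually_forall_ge_atTop.2 (hlim.and
      (eventually_ge_atTop (4 * C + 10)))))
  refine ⟨T, fun t ht => ?_⟩
  obtain ⟨hexp, htC⟩ := hT T le_rfl t ht
  have ht0 : 0 < t := by linarith
  obtain ⟨hE0, hW0⟩ := hpos ht0.le
  by_contra hlt
  rw [not_le, approxFunction_apply] at hlt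
  obtain ⟨m, η, hηdef, -, hmcos⟩ := exists_eq_int_mul_two_pi_add t
  obtain ⟨n, δ, hδdef, hδcos, hncos⟩ := exists_eq_int_mul_two_pi_add (a * t)
  have hη2 : |η| * t ^ 2 ≤ κ := by
    have h1 : Real.exp t * (2 / Real.pi ^ 2 * η ^ 2) ≤ B :=
      (mul_le_mul_of_nonneg_left hmcos (Real.exp_pos t).le).trans (by linarith)
    have h2 : η ^ 2 ≤ C * Real.exp (-t) := by
      rw [Real.exp_neg, ← div_eq_mul_inv, le_div_iff₀ (Real.exp_pos t), hC,
        le_div_iff₀ two_pos]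
      have := mul_le_mul_of_nonneg_right h1 (sq_nonneg Real.pi)
      calc η ^ 2 * Real.exp t * 2 = Real.exp t * (2 / Real.pi ^ 2 * η ^ 2) * Real.pi ^ 2 := by
            field_simp
        _ ≤ _ := this
    refine abs_le_of_sq_le_sq' ?_ hκ0.le |>.2
    calc (|η| * t ^ 2) ^ 2 = η ^ 2 * t ^ 4 := by rw [mul_pow, sq_abs]; ring
      _ ≤ C * Real.exp (-t) * t ^ 4 := by gcongr
      _ = C * (t ^ 4 * Real.exp (-t)) := by ring
      _ ≤ κ ^ 2 := hexp.le
  have hη1 : |η| ≤ 1 / 2 := by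
    have : |η| * 1 ≤ |η| * t ^ 2 := by gcongr; nlinarith
    linarith
  have hδ2 : δ ^ 2 * t ^ 2 ≤ C := by
    have h1 : t ^ 2 * (2 / Real.pi ^ 2 * δ ^ 2) ≤ B := by
      refine le_trans ?_ (show (t ^ 2 + 3 * t) * (1 - Real.cos (a * t)) ≤ B by linarith)
      have : t ^ 2 ≤ t ^ 2 + 3 * t := by linarith
      gcongr
    rw [hC, le_div_iff₀ two_pos]
    calc δ ^ 2 * t ^ 2 * 2 = t ^ 2 * (2 / Real.pi ^ 2 * δ ^ 2) * Real.pi ^ 2 := by field_simp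
      _ ≤ _ := by gcongr
  have hδ1 : |δ| ≤ 1 := by
    rw [← sq_le_one_iff_abs_le_one]
    have h1 : C ≤ t ^ 2 := by nlinarith
    by_contra h
    have : 1 * t ^ 2 < δ ^ 2 * t ^ 2 := by gcongr; exact not_le.1 h
    linarith
  have hcosδ : δ ^ 2 / 2 * (1 - δ ^ 2) ≤ 1 - Real.cos (a * t) := by
    have h1 := (abs_le.1 (Real.cos_bound hδ1)).2
    rw [hδcos] at h1
    have h2 : |δ| ^ 4 = (δ ^ 2) ^ 2 := by rw [← sq_abs δ]; ring
    rw [h2] at h1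
    nlinarith [sq_nonneg (δ ^ 2)]
  have hW : (t + 1) ^ 2 * δ ^ 2 < (4 * Real.pi ^ 2 * L) ^ 2 := by
    -- The surplus t - 1 of t² + 3t over (t + 1)² covers the loss δ²(t² + 3t) ≤ 4C, since t ≥ 4C +
    -- 10.
    have h1 : (t + 1) ^ 2 ≤ (t ^ 2 + 3 * t) * (1 - δ ^ 2) := by
      have h3 : δ ^ 2 * (3 * t) ≤ 3 * C := by
        have : δ ^ 2 * (3 * t) ≤ 3 * (δ ^ 2 * t ^ 2) := by
          have h4 : t ≤ t ^ 2 := by rw [pow_two]; exact le_mul_of_one_le_left ht0.le (by linarith)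
          have h5 := mul_le_mul_of_nonneg_left h4 (sq_nonneg δ)
          linarith
        linarith
      linarith
    have h2 : (t + 1) ^ 2 * δ ^ 2 ≤ 2 * ((t ^ 2 + 3 * t) * (1 - Real.cos (a * t))) := by
      calc (t + 1) ^ 2 * δ ^ 2 ≤ (t ^ 2 + 3 * t) * (1 - δ ^ 2) * δ ^ 2 := by gcongr
        _ = 2 * ((t ^ 2 + 3 * t) * (δ ^ 2 / 2 * (1 - δ ^ 2))) := by ring
        _ ≤ _ := by gcongr
    have h3 : (4 * Real.pi ^ 2 * L) ^ 2 = 2 * B := by rw [hB]; ring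
    linarith
  have hWabs : (t + 1) * |δ| < 4 * Real.pi ^ 2 * L := by
    refine lt_of_pow_lt_pow_left₀ 2 (by positivity) ?_
    rwa [mul_pow, sq_abs]
  have hη' := abs_le.1 hη1
  have hm0 : 0 < m := by
    have : (0 : ℝ) < m * (2 * Real.pi) := by linarith
    exact_mod_cast (pos_iff_pos_of_mul_pos this).2 (by positivity)
  have hm0' : (0 : ℝ) < m := by exact_mod_cast hm0
  have hdioph : 4 * Real.pi ^ 2 * L ≤ (t + |η|) * (|δ| + a * |η|) := by
    have h1 := diophantineType_le (a := a) hm0.ne' n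
    rw [← hLdef, abs_of_pos hm0'] at h1
    have h2 : 2 * Real.pi * |m * a - n| ≤ |δ| + a * |η| := by
      have e : 2 * Real.pi * (m * a - n) = δ - a * η := by
        linear_combination hδdef - a * hηdef
      rw [← abs_of_pos (by positivity : 0 < 2 * Real.pi), ← abs_mul, e]
      refine (abs_sub _ _).trans_eq ?_
      rw [abs_mul, abs_of_pos ha]
    have h3 : 2 * Real.pi * m ≤ t + |η| := by
      have := neg_abs_le η
      linarith
    calc 4 * Real.pi ^ 2 * L ≤ 4 * Real.pi ^ 2 * (m * |m * a - n|) := by gcongr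
      _ = (2 * Real.pi * m) * (2 * Real.pi * |m * a - n|) := by ring
      _ ≤ _ := by gcongr
  have hη0 := abs_nonneg η
  have h1 : (t + |η|) * ((t + 1) * |δ|) < (t + |η|) * (4 * Real.pi ^ 2 * L) := by gcongr
  have h2 : (t + |η|) * (t + 1) * (a * |η|) ≤ 4 * a * κ := by
    calc (t + |η|) * (t + 1) * (a * |η|) ≤ (2 * t) * (2 * t) * (a * |η|) := by
          gcongr <;> linarith
      _ = 4 * a * (|η| * t ^ 2) := by ring
      _ ≤ 4 * a * κ := by gcongr
  have h3 : (4 * Real.pi ^ 2 * L) * (t + 1) ≤ (t + |η|) * (|δ| + a * |η|) * (t + 1) := by gcongr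
  have h4 : 4 * Real.pi ^ 2 * L * |η| ≤ 4 * Real.pi ^ 2 * L * (1 / 2) := by gcongr
  -- Multiplying `hdioph` by t + 1 and using `hWabs` leaves 4π²L(1 - |η|) < 4aκ ≤ 2π²L, which is
  -- impossible for |η| ≤ 1/2.
  linarith

/-! ### The main theorem -/

theorem mainTheorem4 (a : ℝ) (ha : 0 < a) (halg : IsAlgebraic ℚ a) :
    (SkolemDecidable → IsComputableReal (diophantineType a)) ∧
      (SkolemDecidableOn SkolemInstance.HasTwoFrequencies →
        IsComputableReal (diophantineType a)) := by
  have main (hS : SkolemDecidableOn SkolemInstance.HasTwoFrequencies) :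
      IsComputableReal (diophantineType a) := by
    by_cases hirr : Irrational a
    · rcases (diophantineType_nonneg a).eq_or_lt with h0 | h0
      · rw [← h0]
        exact isComputableReal_zero
      -- An attained type has to be separated: large denominators might then stay away from it, and
      -- f would detect the wrong threshold.
      by_cases hna : ∀ m n : ℤ, 0 < m → (m : ℝ) * |m * a - n| ≠ diophantineType a
      · obtain ⟨T, hT⟩ := exists_approxFunction_ge ha
        exact isComputableReal_of_approxFunction_threshold hirr halg hS h0.le hT
          fun c hc => exists_approxFunction_eq hna T hc
      · push Not at hna
        obtain ⟨m, n, -, hmn⟩ := hna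
        refine isComputableReal_of_isAlgebraic hirr halg hS h0 ?_
        have hm : IsAlgebraic ℚ (m : ℝ) := isAlgebraic_intCast m
        have hd := (hm.mul halg).sub (isAlgebraic_intCast (R := ℚ) (A := ℝ) n)
        rw [← hmn]
        rcases abs_choice ((m : ℝ) * a - n) with h | h <;> rw [h]
        exacts [hm.mul hd, hm.mul hd.neg]
    · obtain ⟨q, rfl⟩ := not_not.1 hirr
      rw [diophantineType_ratCast]
      exact isComputableReal_zero
  refine ⟨fun ⟨D, hD, h⟩ => main ⟨D, hD, fun c S hc _ => h c S hc trivial⟩, main⟩
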